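/- Let $f$ be a real-valued function on a set $S\subset\mathbb R^n$. Call $f$ \emph{convex} on $S$ if $f(\lambda_1x_1+\cdots+\lambda_kx_k)\le\lambda_1f(x_1)+\cdots+\lambda_kf(x_k)$ whenever $x_1,\dots,x_k\in S$, $\lambda_i\ge 0$, $\lambda_1+\cdots+\lambda_k=1$ and $\lambda_1x_1+\cdots+\lambda_kx_k\in S$ ($S$ itself need not be convex). Call $f$ \emph{locally convex} on $S$ if every $x\in S$ is the centre of a ball $B$ such that $f$ is convex on $B\cap S$, and \emph{interval convex} on $S$ if $f$ is convex on every straight line segment contained in $S$. Theorem. Let $\Omega\subset\mathbb R^n$ be a convex set, and let $\dim\Omega$ be the dimension of its affine hull. Let $A\subset\mathbb R^n$ be a set such that $A\cap\Omega$ is closed in $\Omega$ (for instance a closed subset of $\mathbb R^n$), whose Hausdorff dimension is at most $\dim\Omega-2$ (the empty set $A=\emptyset$ is always allowed). Then for every continuous function $f:\Omega\setminus A\to\mathbb R$ the following are equivalent: (1) $f$ is convex on $\Omega\setminus A$; (2) $f$ is locally convex on $\Omega\setminus A$; (3) $f$ is interval convex on $\Omega\setminus A$. -/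

import Mathlib

/-- The function `f` is convex on the (not necessarily convex) set `S`: the Jensen inequality holds
for every convex combination of finitely many points of `S`, as soon as that combination again
lies in `S`. Only the values of `f` on `S` matter. -/
def IsConvexFn {n : ℕ} (S : Set (EuclideanSpace ℝ (Fin n))) (f : EuclideanSpace ℝ (Fin n) → ℝ) :
    Prop :=
  ∀ (k : ℕ) (w : Fin k → ℝ) (x : Fin k → EuclideanSpace ℝ (Fin n)),
    (∀ i, 0 ≤ w i) → ∑ i, w i = 1 → (∀ i, x i ∈ S) → ∑ i, w i • x i ∈ S →
      f (∑ i, w i • x i) ≤ ∑ i, w i * f (x i)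

/-- The function `f` is locally convex on `S`: every point of `S` is the centre of a ball `B` such
that `f` is convex on `B ∩ S`. -/
def IsLocallyConvexFn {n : ℕ} (S : Set (EuclideanSpace ℝ (Fin n)))
    (f : EuclideanSpace ℝ (Fin n) → ℝ) : Prop :=
  ∀ x ∈ S, ∃ r > 0, IsConvexFn (Metric.ball x r ∩ S) f

/-- The function `f` is interval convex on `S`: it is convex on every straight line segment
contained in `S`. -/
def IsIntervalConvexFn {n : ℕ} (S : Set (EuclideanSpace ℝ (Fin n)))
    (f : EuclideanSpace ℝ (Fin n) → ℝ) : Prop :=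
  ∀ x y : EuclideanSpace ℝ (Fin n), segment ℝ x y ⊆ S → IsConvexFn (segment ℝ x y) f

/-- The dimension of a convex set: the dimension of its affine hull. -/
noncomputable def convexDim {n : ℕ} (S : Set (EuclideanSpace ℝ (Fin n))) : ℕ :=
  Module.finrank ℝ (affineSpan ℝ S).direction

/-! Convexity restricts to subsets, so (2) and (3) follow from (1). Conversely, each gives the
two-point inequality on segments inside `Ω \ A`; under (2), `f` minus its chord cannot have a
positive maximum (`nonpos_of_local_midpoint`).

If the segment from `x` to `y` meets `A`, perturb `y`. The directions from `x` that hit `A` form a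
radial projection of `A`, of dimension at most `dimH A`, while all directions fill a hyperplane of
dimension `dim Ω - 1 > dimH A`. So endpoints near `y` with unobstructed segments exist, and
continuity gives the inequality for `y`.

Jensen for `k` points follows by induction, merging all points but one into a barycentre. If it lies
in `A`, moving one point pushes it off; this needs only `dimH A < dim Ω`. -/

/-! ### Avoiding small sets inside a convex set -/

open Set Filter Topology Module in
/-- A set of Hausdorff dimension less than that of an isometrically embedded space `F` misses
arbitrarily small vectors of `F`. -/
lemma exists_norm_lt_notMem_of_dimH_lt {E F : Type*} [NormedAddCommGroup E] [InnerProductSpace ℝ E]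
    [NormedAddCommGroup F] [InnerProductSpace ℝ F] [FiniteDimensional ℝ F] (L : F →ₗᵢ[ℝ] E)
    {B : Set E} (hB : dimH B < finrank ℝ F) {δ : ℝ} (hδ : 0 < δ) :
    ∃ w : F, ‖w‖ < δ ∧ L w ∉ B := by
  have h : dimH (L ⁻¹' B) < finrank ℝ F := by
    rw [← L.isometry.dimH_image]
    exact (dimH_mono (image_preimage_subset _ _)).trans_lt hB
  obtain ⟨w, hw, hw'⟩ := (dense_compl_of_dimH_lt_finrank h).exists_dist_lt 0 hδ
  exact ⟨w, by simpa using hw', hw⟩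

open Set Filter Topology Module in
/-- A nonempty convex set contains a relative ball, in the direction of its affine span. -/
lemma Convex.exists_relative_ball {E : Type*} [NormedAddCommGroup E] [InnerProductSpace ℝ E]
    [FiniteDimensional ℝ E] {Ω : Set E} (hΩ : Convex ℝ Ω) (hne : Ω.Nonempty) :
    ∃ p ∈ Ω, ∃ r > 0, ∀ v ∈ (affineSpan ℝ Ω).direction, ‖v‖ < r → p + v ∈ Ω := by
  obtain ⟨p, hp⟩ := hne.intrinsicInterior hΩ
  refine ⟨p, intrinsicInterior_subset hp, ?_⟩
  obtain ⟨q, hq, rfl⟩ := mem_intrinsicInterior.1 hp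
  obtain ⟨r, hr, hball⟩ := Metric.isOpen_iff.1 isOpen_interior q hq
  refine ⟨r, hr, fun v hv hvr => ?_⟩
  have hmem : v +ᵥ (q : E) ∈ affineSpan ℝ Ω := AffineSubspace.vadd_mem_of_mem_direction hv q.2
  have h : (⟨v +ᵥ (q : E), hmem⟩ : affineSpan ℝ Ω) ∈ Metric.ball q r := by
    rw [Metric.mem_ball, Subtype.dist_eq]
    simpa [dist_eq_norm] using hvr
  have := interior_subset (hball h)
  simpa [add_comm] using this

open Set Filter Topology Module in
/-- Near every point of a convex set there are centres of relative balls. -/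
lemma Convex.exists_relative_ball_near {E : Type*} [NormedAddCommGroup E] [InnerProductSpace ℝ E]
    [FiniteDimensional ℝ E] {Ω : Set E} (hΩ : Convex ℝ Ω) {y : E} (hy : y ∈ Ω) {δ : ℝ}
    (hδ : 0 < δ) :
    ∃ q ∈ Ω, dist q y < δ ∧
      ∃ r > 0, ∀ v ∈ (affineSpan ℝ Ω).direction, ‖v‖ < r → q + v ∈ Ω := by
  obtain ⟨p, hp, r, hr, hball⟩ := hΩ.exists_relative_ball ⟨y, hy⟩
  have hc : Tendsto (fun ε : ℝ => y + ε • (p - y)) (𝓝[>] 0) (𝓝 y) := by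
    have : Continuous (fun ε : ℝ => y + ε • (p - y)) := by fun_prop
    simpa using (this.tendsto 0).mono_left (nhdsWithin_le_nhds (s := Ioi 0))
  obtain ⟨ε, hε, hε0, hε1⟩ := ((hc.eventually (Metric.ball_mem_nhds y hδ)).and
    (Ioc_mem_nhdsGT (zero_lt_one' ℝ))).exists
  -- The homothety of centre `y` and ratio `ε` shrinks the ball about `p` to one of radius `ε * r`.
  refine ⟨_, hΩ.add_smul_sub_mem hy hp ⟨hε0.le, hε1⟩, hε, ε * r, by positivity, fun v hv hvr => ?_⟩
  have h : p + ε⁻¹ • v ∈ Ω := by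
    refine hball _ (Submodule.smul_mem _ _ hv) ?_
    rw [norm_smul, norm_inv, Real.norm_of_nonneg hε0.le, inv_mul_lt_iff₀ hε0]
    exact hvr
  convert hΩ.add_smul_sub_mem hy h ⟨hε0.le, hε1⟩ using 1
  rw [add_sub_right_comm, smul_add ε, smul_smul, mul_inv_cancel₀ hε0.ne', one_smul, add_assoc]

open Set Filter Topology Module in
/-- The complement of a set of small Hausdorff dimension is dense in a convex set. -/
lemma Convex.mem_closure_diff_of_dimH_lt {E : Type*} [NormedAddCommGroup E] [InnerProductSpace ℝ E]
    [FiniteDimensional ℝ E] {Ω B : Set E} (hΩ : Convex ℝ Ω)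
    (hB : dimH B < finrank ℝ (affineSpan ℝ Ω).direction) {y : E} (hy : y ∈ Ω) :
    y ∈ closure (Ω \ B) := by
  refine Metric.mem_closure_iff.2 fun δ hδ => ?_
  obtain ⟨q, -, hqy, r, hr, hball⟩ := hΩ.exists_relative_ball_near hy (half_pos hδ)
  have hB' : dimH ((fun b => b - q) '' B) < finrank ℝ (affineSpan ℝ Ω).direction :=
    ((LipschitzWith.of_dist_le_mul (K := 1) (by simp)).dimH_image_le B).trans_lt hB
  obtain ⟨w, hw, hwB⟩ := exists_norm_lt_notMem_of_dimH_lt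
    (affineSpan ℝ Ω).direction.subtypeₗᵢ hB' (lt_min hr (half_pos hδ))
  refine ⟨q + w, ⟨hball w w.2 (hw.trans_le (min_le_left _ _)), fun h => hwB ⟨_, h, by simp⟩⟩, ?_⟩
  have h1 : dist (q + (w : E)) q < δ / 2 := by
    simpa [dist_eq_norm] using hw.trans_le (min_le_right _ _)
  linarith [dist_triangle (q + (w : E)) q y, dist_comm y (q + (w : E))]

open Set Filter Topology Module in
/-- The radial projection from `x` to the hyperplane through `x + v` orthogonal to `v` does not
raise the Hausdorff dimension. -/
lemma dimH_radialProjection_le {E : Type*} [NormedAddCommGroup E] [InnerProductSpace ℝ E]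
    [FiniteDimensional ℝ E] (x v : E) (A : Set E) :
    dimH ((fun a => (‖v‖ ^ 2 / inner ℝ v (a - x)) • (a - x) - v) ''
      (A ∩ {a | 0 < inner ℝ v (a - x)})) ≤ dimH A := by
  -- On this half-space the projection is `C¹`, hence locally Lipschitz; convexity of the domain is
  -- what the dimension bound asks for.
  have hconv : Convex ℝ {a : E | 0 < inner ℝ v (a - x)} := by
    have : {a : E | 0 < inner ℝ v (a - x)} = {a : E | inner ℝ v x < inner ℝ v a} := by
      ext a; simp [inner_sub_right]
    rw [this]
    exact convex_halfSpace_gt (innerₛₗ ℝ v).isLinear _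
  have hd : ContDiffOn ℝ 1 (fun a : E => (‖v‖ ^ 2 / inner ℝ v (a - x)) • (a - x) - v)
      {a | 0 < inner ℝ v (a - x)} := by
    refine ContDiffOn.sub (ContDiffOn.smul (ContDiffOn.div contDiffOn_const ?_ ?_) ?_)
      contDiffOn_const
    · exact (contDiff_const.inner ℝ (contDiff_id.sub contDiff_const)).contDiffOn
    · exact fun a ha => ne_of_gt ha
    · exact (contDiff_id.sub contDiff_const).contDiffOn
  exact (hd.dimH_image_le hconv inter_subset_right).trans (dimH_mono inter_subset_left)

open Set Filter Topology Module in
/-- If `A` has codimension at least two, almost every segment issuing from `x ∉ A` avoids `A`. -/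
lemma Convex.mem_closure_segment_subset_diff {E : Type*} [NormedAddCommGroup E]
    [InnerProductSpace ℝ E] [FiniteDimensional ℝ E] {Ω A : Set E} (hΩ : Convex ℝ Ω)
    (hdim : A.Nonempty → dimH A + 2 ≤ finrank ℝ (affineSpan ℝ Ω).direction)
    {x y : E} (hx : x ∈ Ω \ A) (hy : y ∈ Ω) (hxy : x ≠ y) :
    y ∈ closure {z | segment ℝ x z ⊆ Ω \ A} := by
  rcases A.eq_empty_or_nonempty with rfl | hne
  · exact subset_closure (by simpa using hΩ.segment_subset hx.1 hy)
  replace hdim := hdim hne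
  refine Metric.mem_closure_iff.2 fun δ hδ => ?_
  -- The bound `dist x y` forces `q ≠ x`, so `q - x` is a valid axis.
  obtain ⟨q, hq, hqy, r, hr, hball⟩ := hΩ.exists_relative_ball_near hy
    (lt_min (half_pos hδ) (dist_pos.2 hxy))
  have hqx : q - x ≠ 0 := by
    intro h
    rw [sub_eq_zero.1 h] at hqy
    exact absurd (hqy.trans_le (min_le_right _ _)) (lt_irrefl _)
  obtain ⟨m, hm⟩ : ∃ m, finrank ℝ (affineSpan ℝ Ω).direction = m + 1 + 1 := by
    have h2 : (2 : ENNReal) ≤ finrank ℝ (affineSpan ℝ Ω).direction := le_add_self.trans hdim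
    exact Nat.exists_eq_add_of_le' (by exact_mod_cast h2)
  have : Fact (finrank ℝ (affineSpan ℝ Ω).direction = m + 1 + 1) := ⟨hm⟩
  let v : (affineSpan ℝ Ω).direction := ⟨q - x, AffineSubspace.vsub_mem_direction
    (subset_affineSpan ℝ Ω hq) (subset_affineSpan ℝ Ω hx.1)⟩
  have hv : v ≠ 0 := fun h => hqx (congrArg Subtype.val h)
  let B := (fun a => (‖q - x‖ ^ 2 / inner ℝ (q - x) (a - x)) • (a - x) - (q - x)) ''
      (A ∩ {a | 0 < inner ℝ (q - x) (a - x)})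
  have hB : dimH B < finrank ℝ (ℝ ∙ v)ᗮ := by
    rw [Submodule.finrank_orthogonal_span_singleton (n := m + 1) hv]
    refine (dimH_radialProjection_le x (q - x) A).trans_lt ?_
    have hlt : dimH A ≤ m := by
      rw [hm] at hdim
      push_cast at hdim
      rw [add_assoc, one_add_one_eq_two] at hdim
      exact (ENNReal.add_le_add_iff_right (by simp)).1 hdim
    exact hlt.trans_lt (by exact_mod_cast m.lt_succ_self)
  -- The shift is orthogonal to `q - x` within the direction of `Ω`, a space of dimension `m + 1`.
  obtain ⟨w, hw, hwB⟩ := exists_norm_lt_notMem_of_dimH_lt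
    ((affineSpan ℝ Ω).direction.subtypeₗᵢ.comp (ℝ ∙ v)ᗮ.subtypeₗᵢ) hB (lt_min hr (half_pos hδ))
  set u : E := ((w : (affineSpan ℝ Ω).direction) : E) with hu
  have hunorm : ‖u‖ = ‖w‖ := rfl
  have horth : inner ℝ (q - x) u = 0 :=
    Submodule.mem_orthogonal_singleton_iff_inner_right (u := v).1 w.2
  have hmem : q + u ∈ Ω := hball u w.1.2 (hw.trans_le (min_le_left _ _))
  refine ⟨q + u, fun a ha => ⟨hΩ.segment_subset hx.1 hmem ha, fun haA => ?_⟩, ?_⟩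
  · rw [segment_eq_image'] at ha
    obtain ⟨t, ⟨ht0, ht1⟩, rfl⟩ := ha
    rcases ht0.eq_or_lt with rfl | ht
    · exact hx.2 (by simpa using haA)
    have hpos : 0 < ‖q - x‖ ^ 2 := by positivity
    have hin : inner ℝ (q - x) (x + t • (q + u - x) - x) = t * ‖q - x‖ ^ 2 := by
      rw [add_sub_cancel_left, inner_smul_right, add_sub_right_comm, inner_add_right, horth,
        real_inner_self_eq_norm_sq, add_zero]
    -- A point of `A` on the segment would project radially to `q + u`, putting `u` in `B`.
    refine hwB ⟨_, ⟨haA, ?_⟩, ?_⟩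
    · rw [mem_ofPred_eq, hin]; positivity
    · have hs : ‖q - x‖ ^ 2 / (t * ‖q - x‖ ^ 2) * t = 1 := by field_simp
      simp only [hin]
      rw [add_sub_cancel_left, smul_smul, hs, one_smul, add_sub_right_comm, add_sub_cancel_left]
      rfl
  · have h1 : dist (q + u) q < δ / 2 := by
      simpa [dist_eq_norm, hunorm] using hw.trans_le (min_le_right _ _)
    have h2 := hqy.trans_le (min_le_left _ _)
    linarith [dist_triangle (q + u) q y, dist_comm y (q + u)]

/-! ### From local convexity to segments -/

open Set Filter Topology in
/-- A continuous function on `[0, 1]` that is nonpositive at the ends and satisfies the midpoint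
inequality for all small centred intervals is nonpositive. -/
lemma nonpos_of_local_midpoint {h : ℝ → ℝ} (hc : ContinuousOn h (Icc 0 1)) (h0 : h 0 ≤ 0)
    (h1 : h 1 ≤ 0)
    (hmid : ∀ t ∈ Ioo (0 : ℝ) 1, ∃ r > 0, ∀ s ∈ Ioo 0 r, 0 ≤ t - s → t + s ≤ 1 →
      2 * h t ≤ h (t - s) + h (t + s)) :
    ∀ t ∈ Icc (0 : ℝ) 1, h t ≤ 0 := by
  obtain ⟨m, hm, hmax⟩ := isCompact_Icc.exists_isMaxOn (nonempty_Icc.2 zero_le_one) hc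
  by_contra! hpos
  obtain ⟨t, ht, htpos⟩ := hpos
  have hM : 0 < h m := htpos.trans_le (hmax ht)
  have hK : IsCompact (Icc (0 : ℝ) 1 ∩ h ⁻¹' {h m}) :=
    isCompact_Icc.of_isClosed_subset (hc.preimage_isClosed_of_isClosed isClosed_Icc
      isClosed_singleton) inter_subset_left
  -- At the leftmost maximum the left neighbour is strictly smaller, which contradicts the midpoint
  -- inequality.
  obtain ⟨a, ⟨ha, haM⟩, hleast⟩ := hK.exists_isLeast ⟨m, hm, rfl⟩
  replace haM : h a = h m := haM
  have ha0 : 0 < a := ha.1.lt_of_ne (by rintro rfl; linarith)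
  have ha1 : a < 1 := ha.2.lt_of_ne (by rintro rfl; linarith)
  obtain ⟨r, hr, hrm⟩ := hmid a ⟨ha0, ha1⟩
  obtain ⟨s, hs0, hs⟩ := exists_between (lt_min hr (lt_min ha0 (sub_pos.2 ha1)))
  have hs1 : s < r := hs.trans_le (min_le_left _ _)
  have hs2 : s < a := hs.trans_le ((min_le_right _ _).trans (min_le_left _ _))
  have hs3 : s < 1 - a := hs.trans_le ((min_le_right _ _).trans (min_le_right _ _))
  have hl : a - s ∈ Icc (0 : ℝ) 1 := ⟨by linarith, by linarith⟩
  have hr' : a + s ∈ Icc (0 : ℝ) 1 := ⟨by linarith, by linarith⟩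
  have e1 : h (a - s) ≤ h m := hmax hl
  have e2 : h (a + s) ≤ h m := hmax hr'
  have e3 : h (a - s) ≠ h m := fun he => by linarith [hleast ⟨hl, he⟩]
  have e4 := lt_of_le_of_ne e1 e3
  linarith [hrm s ⟨hs0, hs1⟩ (by linarith) (by linarith)]

lemma IsConvexFn.mono {n : ℕ} {S T : Set (EuclideanSpace ℝ (Fin n))}
    {f : EuclideanSpace ℝ (Fin n) → ℝ} (h : IsConvexFn S f) (hT : T ⊆ S) : IsConvexFn T f :=
  fun k w x hw hw1 hx hm => h k w x hw hw1 (fun i => hT (hx i)) (hT hm)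

lemma IsConvexFn.le_pair {n : ℕ} {S : Set (EuclideanSpace ℝ (Fin n))}
    {f : EuclideanSpace ℝ (Fin n) → ℝ} (h : IsConvexFn S f) {x y : EuclideanSpace ℝ (Fin n)}
    (hx : x ∈ S) (hy : y ∈ S) {a b : ℝ} (ha : 0 ≤ a) (hb : 0 ≤ b) (hab : a + b = 1)
    (hm : a • x + b • y ∈ S) : f (a • x + b • y) ≤ a * f x + b * f y := by
  have := h 2 ![a, b] ![x, y] (by simp [Fin.forall_fin_two, ha, hb]) (by simpa using hab)
    (by simp [Fin.forall_fin_two, hx, hy]) (by simpa using hm)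
  simpa using this

open Set Filter Topology in
/-- Continuous locally convex functions satisfy the two-point inequality on segments. -/
lemma IsLocallyConvexFn.le_pair_of_segment_subset {n : ℕ} {S : Set (EuclideanSpace ℝ (Fin n))}
    {f : EuclideanSpace ℝ (Fin n) → ℝ} (h : IsLocallyConvexFn S f) (hf : ContinuousOn f S)
    {x y : EuclideanSpace ℝ (Fin n)} (hxy : segment ℝ x y ⊆ S) {a b : ℝ} (ha : 0 ≤ a)
    (hb : 0 ≤ b) (hab : a + b = 1) : f (a • x + b • y) ≤ a * f x + b * f y := by
  let γ : ℝ → EuclideanSpace ℝ (Fin n) := fun t => (1 - t) • x + t • y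
  have hγ : Continuous γ := by fun_prop
  have hγS : MapsTo γ (Icc 0 1) S := fun t ht =>
    hxy ⟨1 - t, t, by linarith [ht.2], ht.1, by ring, rfl⟩
  have key := nonpos_of_local_midpoint (h := fun t => f (γ t) - ((1 - t) * f x + t * f y))
    ((hf.comp hγ.continuousOn hγS).sub (by fun_prop)) (by simp [γ]) (by simp [γ]) ?_ b
    ⟨hb, by linarith⟩
  · have ha' : a = 1 - b := by linarith
    subst ha'
    simpa [γ] using key
  intro t ht
  obtain ⟨ρ, hρ, hconv⟩ := h (γ t) (hγS (Ioo_subset_Icc_self ht))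
  obtain ⟨r, hr, hball⟩ := Metric.isOpen_iff.1 (Metric.isOpen_ball.preimage hγ) t
    (Metric.mem_ball_self hρ)
  refine ⟨r, hr, fun s hs h0 h1 => ?_⟩
  have hmid : (1 / 2 : ℝ) • γ (t - s) + (1 / 2 : ℝ) • γ (t + s) = γ t := by
    simp only [γ]; module
  have := hconv.le_pair (x := γ (t - s)) (y := γ (t + s)) (a := 1 / 2) (b := 1 / 2)
    ⟨hball (by simp [abs_of_pos hs.1, hs.2]), hγS ⟨h0, by linarith [hs.1, ht.2]⟩⟩
    ⟨hball (by simp [abs_of_pos hs.1, hs.2]), hγS ⟨by linarith [hs.1, ht.1], h1⟩⟩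
    (by norm_num) (by norm_num) (by norm_num)
    (by rw [hmid]; exact ⟨Metric.mem_ball_self hρ, hγS (Ioo_subset_Icc_self ht)⟩)
  rw [hmid] at this
  linarith

/-! ### From segments to pairs, and from pairs to Jensen -/

open Set Filter Topology in
/-- Off a closed set of codimension at least two, the two-point inequality on segments contained in
the domain implies the inequality for all pairs. -/
lemma le_pair_of_le_pair_of_segment_subset {n : ℕ} {Ω A : Set (EuclideanSpace ℝ (Fin n))}
    (hΩ : Convex ℝ Ω) (hdim : A.Nonempty → dimH A + 2 ≤ (convexDim Ω : ENNReal))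
    {f : EuclideanSpace ℝ (Fin n) → ℝ} (hf : ContinuousOn f (Ω \ A))
    (h : ∀ x y : EuclideanSpace ℝ (Fin n), segment ℝ x y ⊆ Ω \ A → ∀ a b : ℝ, 0 ≤ a → 0 ≤ b →
      a + b = 1 → f (a • x + b • y) ≤ a * f x + b * f y)
    {x y : EuclideanSpace ℝ (Fin n)} (hx : x ∈ Ω \ A) (hy : y ∈ Ω \ A) {a b : ℝ} (ha : 0 ≤ a)
    (hb : 0 ≤ b) (hab : a + b = 1) (hm : a • x + b • y ∈ Ω \ A) :
    f (a • x + b • y) ≤ a * f x + b * f y := by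
  rcases eq_or_ne x y with rfl | hxy
  · rw [← add_smul, ← add_mul, hab, one_smul, one_mul]
  refine ContinuousWithinAt.closure_le (f := fun z => f (a • x + b • z))
    (g := fun z => a * f x + b * f z)
    (hΩ.mem_closure_segment_subset_diff hdim hx hy.1 hxy) ?_ ?_
    fun z hz => h x z hz a b ha hb hab
  · refine ContinuousWithinAt.comp (t := Ω \ A) (hf _ hm)
      (Continuous.continuousWithinAt (by fun_prop)) fun z hz => hz ⟨a, b, ha, hb, hab, rfl⟩
  · exact continuousWithinAt_const.add (continuousWithinAt_const.mul
      ((hf y hy).mono fun z hz => hz (right_mem_segment ℝ x z)))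

open Set Filter Topology Module in
/-- Off a closed set of codimension at least two, the inequality for pairs implies convexity. -/
lemma isConvexFn_of_le_pair {n : ℕ} {Ω A : Set (EuclideanSpace ℝ (Fin n))}
    (hΩ : Convex ℝ Ω)
    (hA : IsClosed ((Subtype.val : Ω → EuclideanSpace ℝ (Fin n)) ⁻¹' A))
    (hdim : A.Nonempty → dimH A + 2 ≤ (convexDim Ω : ENNReal))
    {f : EuclideanSpace ℝ (Fin n) → ℝ} (hf : ContinuousOn f (Ω \ A))
    (h : ∀ x ∈ Ω \ A, ∀ y ∈ Ω \ A, ∀ a b : ℝ, 0 ≤ a → 0 ≤ b → a + b = 1 →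
      a • x + b • y ∈ Ω \ A → f (a • x + b • y) ≤ a * f x + b * f y) :
    IsConvexFn (Ω \ A) f := by
  -- The empty case stays apart: `dimH ∅ = 0`, and `Ω` may then be a point.
  have hdim' : A = ∅ ∨ dimH A < finrank ℝ (affineSpan ℝ Ω).direction := by
    rcases A.eq_empty_or_nonempty with hA | hA
    · exact .inl hA
    have h1 := hdim hA
    have hfin : dimH A ≠ ⊤ := by
      rintro h2
      simp [h2] at h1
    exact .inr ((ENNReal.lt_add_right hfin two_ne_zero).trans_le h1)
  have hnhds : ∀ z ∈ Ω \ A, Ω \ A ∈ 𝓝[Ω] z := by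
    intro z hz
    obtain ⟨U, hU, hUA⟩ := isOpen_induced_iff.1 hA.isOpen_compl
    have hiff : ∀ u, (hu : u ∈ Ω) → (u ∈ U ↔ u ∉ A) := fun u hu => by
      have := Set.ext_iff.1 hUA ⟨u, hu⟩
      simpa using this
    filter_upwards [self_mem_nhdsWithin, mem_nhdsWithin_of_mem_nhds
      (hU.mem_nhds ((hiff z hz.1).2 hz.2))] with u hu huU using ⟨hu, (hiff u hu).1 huU⟩
  intro k
  induction k with
  | zero => intro w x _ hw1; simp at hw1
  | succ k ih =>
    intro w x hw hw1 hx hm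
    rw [Fin.sum_univ_succ] at hw1 hm ⊢
    rw [Fin.sum_univ_succ]
    set b := ∑ i : Fin k, w i.succ with hb
    have hb0 : 0 ≤ b := Finset.sum_nonneg fun i _ => hw _
    rcases hb0.eq_or_lt with hbz | hbpos
    · have hz : ∀ i : Fin k, w i.succ = 0 := fun i =>
        (Finset.sum_eq_zero_iff_of_nonneg fun i _ => hw _).1 hbz.symm i (Finset.mem_univ _)
      have : w 0 = 1 := by linarith
      simp [hz, this]
    obtain ⟨j, -, hj⟩ : ∃ j ∈ (Finset.univ : Finset (Fin k)), 0 < w j.succ := by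
      by_contra! hcon
      exact absurd (Finset.sum_nonpos hcon) (not_le.2 hbpos)
    let w' : Fin k → ℝ := fun i => b⁻¹ * w i.succ
    have hw' : ∀ i, 0 ≤ w' i := fun i => mul_nonneg (inv_nonneg.2 hb0) (hw _)
    have hw'1 : ∑ i, w' i = 1 := by
      rw [← Finset.mul_sum, ← hb, inv_mul_cancel₀ hbpos.ne']
    have hbw : ∀ i, b * w' i = w i.succ := fun i => mul_inv_cancel_left₀ hbpos.ne' _
    let X : EuclideanSpace ℝ (Fin n) → Fin k → EuclideanSpace ℝ (Fin n) :=
      fun z => Function.update (fun i => x i.succ) j z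
    -- Barycentre of the last `k` points, with the point of index `j` (positive weight) moved to
    -- `z`.
    let u : EuclideanSpace ℝ (Fin n) → EuclideanSpace ℝ (Fin n) := fun z => ∑ i, w' i • X z i
    have hX : Continuous X := continuous_const.update j continuous_id
    have hXc : ∀ i, Continuous fun z => X z i := fun i => (continuous_apply i).comp hX
    have huc : Continuous u := continuous_finsetSum _ fun i _ => (hXc i).fun_const_smul _
    have hXself : X (x j.succ) = fun i => x i.succ :=
      Function.update_eq_self j (fun i : Fin k => x i.succ)
    have hXmem : ∀ S : Set (EuclideanSpace ℝ (Fin n)), (∀ i : Fin k, x i.succ ∈ S) → ∀ z ∈ S, ∀ i, X z i ∈ S := by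
      intro S hS z hz i
      rcases eq_or_ne i j with rfl | hij
      · simpa [X] using hz
      · simpa [X, hij] using hS i
    have huΩ : ∀ z ∈ Ω, u z ∈ Ω := fun z hz =>
      hΩ.sum_mem (fun i _ => hw' i) hw'1 fun i _ => hXmem Ω (fun i => (hx _).1) z hz i
    have hcombΩ : ∀ z ∈ Ω, w 0 • x 0 + b • u z ∈ Ω := fun z hz =>
      hΩ (hx 0).1 (huΩ z hz) (hw 0) hb0 hw1
    have hbase : b • u (x j.succ) = ∑ i : Fin k, w i.succ • x i.succ := by
      simp only [u, hXself, Finset.smul_sum, smul_smul, hbw]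
    rw [← hbase] at hm ⊢
    have hbaseF : ∑ i : Fin k, w i.succ * f (x i.succ) = b * ∑ i, w' i * f (X (x j.succ) i) := by
      simp only [hXself, Finset.mul_sum, ← mul_assoc, hbw]
    rw [hbaseF]
    have hdense : x j.succ ∈ closure (Ω \ u ⁻¹' A) := by
      rcases hdim' with rfl | hlt
      · simpa using subset_closure (hx j.succ).1
      refine hΩ.mem_closure_diff_of_dimH_lt (lt_of_le_of_lt ?_ hlt) (hx _).1
      have hwj : 0 < w' j := mul_pos (inv_pos.2 hbpos) hj
      let c := ∑ i ∈ Finset.univ.erase j, w' i • x i.succ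
      -- So `u` is an invertible similarity, and `u ⁻¹' A` is no larger in dimension than `A`.
      have hu : ∀ z, u z = w' j • z + c := by
        intro z
        simp only [u, c]
        rw [← Finset.add_sum_erase _ _ (Finset.mem_univ j)]
        congr 1
        · simp [X]
        · refine Finset.sum_congr rfl fun i hi => ?_
          simp [X, Finset.ne_of_mem_erase hi]
      have hsub : u ⁻¹' A ⊆ (fun a => (w' j)⁻¹ • (a - c)) '' A := fun z hz =>
        ⟨u z, hz, by simp [hu, smul_smul, inv_mul_cancel₀ hwj.ne']⟩
      refine (dimH_mono hsub).trans ?_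
      have hd : ContDiff ℝ 1 fun a : EuclideanSpace ℝ (Fin n) => (w' j)⁻¹ • (a - c) := by fun_prop
      exact hd.contDiffOn.dimH_image_le convex_univ (subset_univ _)
    -- Relative closedness of `A` keeps both the moved point and the full combination in `Ω \ A`.
    let N : Set (EuclideanSpace ℝ (Fin n)) :=
      {z | z ∈ Ω \ A ∧ w 0 • x 0 + b • u z ∈ Ω \ A}
    have hN : N ∈ 𝓝[Ω] (x j.succ) := by
      refine inter_mem (hnhds _ (hx _)) ?_
      have ht : Tendsto (fun z => w 0 • x 0 + b • u z) (𝓝[Ω] (x j.succ))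
          (𝓝[Ω] (w 0 • x 0 + b • u (x j.succ))) := by
        refine ContinuousWithinAt.tendsto_nhdsWithin ?_ hcombΩ
        exact Continuous.continuousWithinAt (by fun_prop)
      exact ht (hnhds _ hm)
    have hcl : x j.succ ∈ closure ((Ω \ u ⁻¹' A) ∩ N) := by
      obtain ⟨V, hV, hVN⟩ := mem_nhdsWithin_iff_exists_mem_nhds_inter.1 hN
      refine mem_closure_iff_nhds.2 fun U hU => ?_
      obtain ⟨z, ⟨hzU, hzV⟩, hz⟩ := mem_closure_iff_nhds.1 hdense _ (inter_mem hU hV)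
      exact ⟨z, hzU, hz, hVN ⟨hzV, hz.1⟩⟩
    refine ContinuousWithinAt.closure_le (f := fun z => f (w 0 • x 0 + b • u z))
      (g := fun z => w 0 * f (x 0) + b * ∑ i, w' i * f (X z i)) hcl ?_ ?_ ?_
    · exact ContinuousWithinAt.comp (t := Ω \ A) (hf _ hm)
        (Continuous.continuousWithinAt (by fun_prop)) fun z hz => hz.2.2
    · refine continuousWithinAt_const.add (continuousWithinAt_const.mul ?_)
      refine tendsto_finsetSum _ fun i _ => Tendsto.const_mul _ ?_
      exact ContinuousWithinAt.comp (f := fun z => X z i) (t := Ω \ A)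
        (hf _ (hXmem _ (fun i => hx _) _ (hx _) i)) (hXc i).continuousWithinAt
        fun z hz => hXmem _ (fun i => hx _) z hz.2.1 i
    · rintro z ⟨⟨hzΩ, hzA⟩, hzS, hzm⟩
      have huS : u z ∈ Ω \ A := ⟨huΩ z hzΩ, hzA⟩
      -- Pair inequality for `x 0` and `u z`, then the induction hypothesis at `u z`.
      refine (h _ (hx 0) _ huS _ _ (hw 0) hb0 hw1 hzm).trans ?_
      gcongr
      exact ih w' (X z) hw' hw'1 (hXmem _ (fun i => hx _) z hzS) huS

/-- The set `A` is closed relative to `Ω` (in particular it may be any closed subset of `ℝⁿ`), and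
its dimension is the Hausdorff dimension, the empty set being of dimension `-∞`. -/
theorem mainTheorem5 {n : ℕ} (Ω A : Set (EuclideanSpace ℝ (Fin n)))
    (hΩ : Convex ℝ Ω)
    (hA : IsClosed ((Subtype.val : Ω → EuclideanSpace ℝ (Fin n)) ⁻¹' A))
    (hdim : A.Nonempty → dimH A + 2 ≤ (convexDim Ω : ENNReal))
    (f : EuclideanSpace ℝ (Fin n) → ℝ) (hf : ContinuousOn f (Ω \ A)) :
    List.TFAE [IsConvexFn (Ω \ A) f, IsLocallyConvexFn (Ω \ A) f, IsIntervalConvexFn (Ω \ A) f] := by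
  have main (h : ∀ x y : EuclideanSpace ℝ (Fin n), segment ℝ x y ⊆ Ω \ A → ∀ a b : ℝ, 0 ≤ a →
      0 ≤ b → a + b = 1 → f (a • x + b • y) ≤ a * f x + b * f y) : IsConvexFn (Ω \ A) f :=
    isConvexFn_of_le_pair hΩ hA hdim hf fun _ hx _ hy _ _ ha hb hab hm =>
      le_pair_of_le_pair_of_segment_subset hΩ hdim hf h hx hy ha hb hab hm
  tfae_have 1 → 2 := fun h _ _ => ⟨1, one_pos, h.mono Set.inter_subset_right⟩
  tfae_have 1 → 3 := fun h _ _ hxy => h.mono hxy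
  tfae_have 2 → 1 := fun h => main fun _ _ hxy _ _ ha hb hab =>
    h.le_pair_of_segment_subset hf hxy ha hb hab
  tfae_have 3 → 1 := fun h => main fun x y hxy a b ha hb hab =>
    (h x y hxy).le_pair (left_mem_segment ℝ x y) (right_mem_segment ℝ x y) ha hb hab
      ⟨a, b, ha, hb, hab, rfl⟩
  tfae_finish
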